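/- Let $0<\alpha\le 2$, let $W$ be a standard Borel space with a $\sigma$-finite measure $Q$, and let $N$ be a real independently scattered symmetric $\alpha$-stable random measure on $W\times\mathbb R$ with control measure $Q\otimes\mathrm{Leb}$, i.e. $E\,e^{i\theta N(A)}=\exp\{-|\theta|^{\alpha}(Q\otimes\mathrm{Leb})(A)\}$ for $\theta\in\mathbb R$ and measurable $A$ with $(Q\otimes\mathrm{Leb})(A)<\infty$, the values of $N$ on disjoint sets are independent, and $N$ is almost surely countably additive. Let $f:W\times\mathbb R\to\mathbb R$ be measurable and such that $$\int_{W\times\mathbb R}|f(x,t-s)-f(x,-s)|^{\alpha}\,Q(dx)\,ds$$ is finite for every $t\in\mathbb R$ and tends to $0$ as $t\to0$. Consider the process $$X_t=\int_{W\times\mathbb R}[f(x,t-s)-f(x,-s)]\,N(dx,ds),\qquad t\in\mathbb R,$$ where the stochastic integral is the limit in probability of the integrals of simple functions converging to the integrand in $L^{\alpha}(Q\otimes\mathrm{Leb})$. Write $f_t(x,s)=f(x,t+s)-f(x,s)$. Let $\beta_1,\beta_2\in\mathbb R$ and suppose that for each $c>0$ there is a measurable bijection $\rho_c:W\to W$ such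 that, for every $t\in\mathbb R$, $$f_{ct}(\rho_c x,cs)=c^{\beta_1}f_t(x,s)\qquad\text{for } Q\otimes\mathrm{Leb}\text{-a.e. }(x,s),$$ and $Q\circ\rho_c=c^{\beta_2}Q$, i.e. $Q(\rho_c(A))=c^{\beta_2}Q(A)$ for every measurable $A\subseteq W$. Then, with $H=(\alpha\beta_1+\beta_2+1)/\alpha$, the processes $\{X_{\lambda t},t\in\mathbb R\}$ and $\{\lambda^{H}X_t,t\in\mathbb R\}$ have the same finite-dimensional distributions for every $\lambda>0$. If moreover $X$ is not degenerate (that is, $P(X_t\neq0)>0$ for some $t$), then $H>0$, so that $X$ is $H$-self-similar in the sense that requires $H>0$. -/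

import Mathlib

open MeasureTheory ProbabilityTheory Filter Topology
open scoped ENNReal

/-- `M` is a (real) independently scattered symmetric `α`-stable random measure on `S` with control
measure `m`, defined on the probability space `(Ω, P)`: a family of random variables `M A` indexed
by the measurable sets `A` with `m A < ∞` (the values of `M` on other sets are irrelevant). -/
structure IsStableRandomMeasure {S Ω : Type*} [MeasurableSpace S] [MeasurableSpace Ω]
    (P : Measure Ω) (α : ℝ) (m : Measure S) (M : Set S → Ω → ℝ) : Prop where
  measurable : ∀ A, MeasurableSet A → m A < ∞ → Measurable (M A)
  /-- `E exp (i t M(A)) = exp (-|t|^α m(A))` -/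
  charFun_eq : ∀ A, MeasurableSet A → m A < ∞ → ∀ t : ℝ,
    charFun (P.map (M A)) t = ((Real.exp (-(|t| ^ α * (m A).toReal)) : ℝ) : ℂ)
  /-- disjoint sets have independent values -/
  indep : ∀ A : ℕ → Set S, (∀ n, MeasurableSet (A n)) → (∀ n, m (A n) < ∞) →
    Pairwise (Function.onFun Disjoint A) → iIndepFun (fun n => M (A n)) P
  /-- almost sure countable additivity -/
  sigma_additive : ∀ A : ℕ → Set S, (∀ n, MeasurableSet (A n)) →
    Pairwise (Function.onFun Disjoint A) → m (⋃ n, A n) < ∞ →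
    ∀ᵐ ω ∂P, Tendsto (fun n => ∑ i ∈ Finset.range n, M (A i) ω) atTop
      (𝓝 (M (⋃ n, A n) ω))

/-- The integral `∑ y M(φ = y)` of a simple function `φ = ∑ y 1_{φ = y}` (the value `y = 0`
contributes nothing). -/
noncomputable def simpleStableIntegral {S Ω : Type*} [MeasurableSpace S]
    (M : Set S → Ω → ℝ) (φ : SimpleFunc S ℝ) (ω : Ω) : ℝ :=
  ∑ y ∈ φ.range, y * M (φ ⁻¹' {y}) ω

/-- `Y` is (a version of) the stochastic integral `∫ g dM`: the limit in probability of the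
integrals of simple functions, each supported on a set of finite `m`-measure, that converge to `g`
in `L^α(m)`. -/
def IsStableIntegral {S Ω : Type*} [MeasurableSpace S] [MeasurableSpace Ω]
    (P : Measure Ω) (α : ℝ) (m : Measure S) (M : Set S → Ω → ℝ) (g : S → ℝ) (Y : Ω → ℝ) : Prop :=
  ∃ φ : ℕ → SimpleFunc S ℝ,
    (∀ n, (φ n).FinMeasSupp m) ∧
    Tendsto (fun n => ∫⁻ p, ‖g p - φ n p‖ₑ ^ α ∂m) atTop (𝓝 0) ∧
    TendstoInMeasure P (fun n => simpleStableIntegral M (φ n)) atTop Y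

/-- The kernel `(x, s) ↦ f(x, t - s) - f(x, -s)` of a mixed moving average process with stationary
increments. -/
def movingAverageKernel {W : Type*} (f : W × ℝ → ℝ) (t : ℝ) (p : W × ℝ) : ℝ :=
  f (p.1, t - p.2) - f (p.1, -p.2)

/-- The increment `f_T(x, s) = f(x, T + s) - f(x, s)`. -/
def incr {W : Type*} (f : W × ℝ → ℝ) (T : ℝ) (p : W × ℝ) : ℝ :=
  f (p.1, T + p.2) - f (p.1, p.2)

/-- The standing assumptions on `f`: it is measurable, its kernels lie in `L^α(Q ⊗ Leb)`, and
they tend to `0` there as `t → 0`. -/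
structure IsAdmissible {W : Type*} [MeasurableSpace W] (α : ℝ) (Q : Measure W)
    (f : W × ℝ → ℝ) : Prop where
  measurable : Measurable f
  lintegral_lt_top : ∀ t : ℝ,
    ∫⁻ p, ‖movingAverageKernel f t p‖ₑ ^ α ∂(Q.prod (volume : Measure ℝ)) < ∞
  tendsto_zero :
    Tendsto (fun t : ℝ => ∫⁻ p, ‖movingAverageKernel f t p‖ₑ ^ α ∂(Q.prod (volume : Measure ℝ)))
      (𝓝 0) (𝓝 0)

/-- Equality in distribution of two real processes indexed by `ℝ`: their finite-dimensional
distributions coincide. -/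
def EqInDistribution {Ω : Type*} [MeasurableSpace Ω] (P : Measure Ω) (X Y : ℝ → Ω → ℝ) : Prop :=
  ∀ I : Finset ℝ, IdentDistrib (fun ω (t : I) => X t ω) (fun ω (t : I) => Y t ω) P P

/-- `{X(λt)} = {λ^H X(t)}` in distribution, for every `λ > 0`. -/
def SelfSimilarScaling {Ω : Type*} [MeasurableSpace Ω] (P : Measure Ω) (X : ℝ → Ω → ℝ)
    (H : ℝ) : Prop :=
  ∀ c : ℝ, 0 < c → EqInDistribution P (fun t => X (c * t)) (fun t ω => c ^ H * X t ω)

/-- `X` is self-similar with parameter `H > 0`. -/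
def IsSelfSimilar {Ω : Type*} [MeasurableSpace Ω] (P : Measure Ω) (X : ℝ → Ω → ℝ)
    (H : ℝ) : Prop :=
  0 < H ∧ SelfSimilarScaling P X H

/-!
The law of a finite family of stable integrals is determined by the functional
`a ↦ ∫ |∑ aᵢ gᵢ|^α` of its integrands (`IsStableIntegral.identDistrib`). Indeed the integral of a
simple function is a combination of independent stable variables, which gives its characteristic
function; finite additivity of the random measure makes the integral linear; and both facts pass to
limits in `L^α`. For `α < 1` the triangle inequality in `L^α` holds for `∫ |g|^α` itself, so the
passage to the limit is phrased with `lpGauge`, which covers both ranges of `α`.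

The map `(x, s) ↦ (ρ_c x, c s)` multiplies `Q ⊗ Leb` by `c ^ (β₂ + 1)` and carries the increments
`f_{ct}` to `c ^ β₁ f_t`, hence replacing all `t` by `ct` multiplies the functional above by
`c ^ (α β₁ + β₂ + 1) = (c ^ H) ^ α` (`lintegral_movingAverageKernel_scaling`), exactly as
multiplying the process by `c ^ H` does. This is the scaling relation.

For a nondegenerate process some `∫ |f_t|^α` is positive, and by the same identity it is
`c ^ (-α H)` times a quantity that tends to `0` as `c → 0`. This rules out `H ≤ 0`.
-/

/-! ### The `L^α` functional for `α > 0` -/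

section LpFunctional

variable {S : Type*} [MeasurableSpace S] {m : Measure S} {α : ℝ}

/-- The power of `∫ |g|^α` that is subadditive in `g`: the `L^α` norm for `1 ≤ α`, and `∫ |g|^α`
itself for `α ≤ 1`. -/
noncomputable def lpGauge (α : ℝ) (m : Measure S) (g : S → ℝ) : ℝ≥0∞ :=
  (∫⁻ p, ‖g p‖ₑ ^ α ∂m) ^ (min 1 α⁻¹)

lemma min_one_inv_pos (hα : 0 < α) : 0 < min 1 α⁻¹ :=
  lt_min one_pos (inv_pos.2 hα)

lemma lpGauge_add_le (hα : 0 < α) {g h : S → ℝ} (hg : Measurable g) (hh : Measurable h) :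
    lpGauge α m (fun p => g p + h p) ≤ lpGauge α m g + lpGauge α m h := by
  unfold lpGauge
  rcases le_total α 1 with h1 | h1
  · rw [min_eq_left ((one_le_inv₀ hα).2 h1)]
    simp only [ENNReal.rpow_one]
    rw [← lintegral_add_left (by fun_prop)]
    refine lintegral_mono fun p => ?_
    exact (ENNReal.rpow_le_rpow (enorm_add_le _ _) hα.le).trans
      (ENNReal.rpow_add_le_add_rpow _ _ hα.le h1)
  · rw [min_eq_right (inv_le_one_of_one_le₀ h1)]
    have := ENNReal.lintegral_Lp_add_le (μ := m) (f := fun p => ‖g p‖ₑ) (g := fun p => ‖h p‖ₑ)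
      (by fun_prop) (by fun_prop) h1
    rw [one_div] at this
    refine le_trans (ENNReal.rpow_le_rpow ?_ (by positivity)) this
    refine lintegral_mono fun p => ?_
    exact ENNReal.rpow_le_rpow (enorm_add_le _ _) hα.le

lemma lpGauge_sub_comm (g h : S → ℝ) :
    lpGauge α m (fun p => g p - h p) = lpGauge α m (fun p => h p - g p) := by
  simp only [lpGauge, enorm_sub_rev]

lemma lpGauge_lt_top_iff (hα : 0 < α) {g : S → ℝ} :
    lpGauge α m g < ∞ ↔ ∫⁻ p, ‖g p‖ₑ ^ α ∂m < ∞ :=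
  ENNReal.rpow_lt_top_iff_of_pos (min_one_inv_pos hα)

lemma tendsto_lpGauge_zero_iff (hα : 0 < α) {ι : Type*} {l : Filter ι} {g : ι → S → ℝ} :
    Tendsto (fun i => lpGauge α m (g i)) l (𝓝 0) ↔
      Tendsto (fun i => ∫⁻ p, ‖g i p‖ₑ ^ α ∂m) l (𝓝 0) := by
  have hk := min_one_inv_pos hα
  constructor <;> intro h
  · have := (ENNReal.continuous_rpow_const (y := (min 1 α⁻¹)⁻¹)).tendsto 0 |>.comp h
    simpa [Function.comp_def, lpGauge, ENNReal.zero_rpow_of_pos (inv_pos.2 hk),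
      ENNReal.rpow_rpow_inv hk.ne'] using this
  · have := (ENNReal.continuous_rpow_const (y := min 1 α⁻¹)).tendsto 0 |>.comp h
    simpa [Function.comp_def, lpGauge, ENNReal.zero_rpow_of_pos hk] using this

lemma lintegral_rpow_lt_top_of_finMeasSupp (hα : 0 < α) {φ : SimpleFunc S ℝ}
    (hφ : φ.FinMeasSupp m) : ∫⁻ p, ‖φ p‖ₑ ^ α ∂m < ∞ := by
  have h := (hφ.map (g := fun y : ℝ => ‖y‖ₑ ^ α) (by simp [hα])).lintegral_lt_top
    (ae_of_all _ fun p => by simp [hα.le])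
  rw [← SimpleFunc.lintegral_eq_lintegral] at h
  exact h

lemma lintegral_rpow_lt_top_of_tendsto (hα : 0 < α) {g : S → ℝ} (hg : Measurable g)
    {φ : ℕ → SimpleFunc S ℝ} (hφ : ∀ n, (φ n).FinMeasSupp m)
    (hlim : Tendsto (fun n => ∫⁻ p, ‖g p - φ n p‖ₑ ^ α ∂m) atTop (𝓝 0)) :
    ∫⁻ p, ‖g p‖ₑ ^ α ∂m < ∞ := by
  obtain ⟨n, hn⟩ := (hlim.eventually (gt_mem_nhds (zero_lt_one' ℝ≥0∞))).exists
  have h := lpGauge_add_le (m := m) hα (hg.sub (φ n).measurable) (φ n).measurable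
  simp only [Pi.sub_apply, sub_add_cancel] at h
  rw [← lpGauge_lt_top_iff hα]
  refine h.trans_lt (ENNReal.add_lt_top.2 ⟨?_, ?_⟩)
  · exact (lpGauge_lt_top_iff hα).2 (hn.trans ENNReal.one_lt_top)
  · exact (lpGauge_lt_top_iff hα).2 (lintegral_rpow_lt_top_of_finMeasSupp hα (hφ n))

lemma tendsto_lintegral_rpow (hα : 0 < α) {g : S → ℝ} (hg : Measurable g)
    {φ : ℕ → SimpleFunc S ℝ}
    (hlim : Tendsto (fun n => ∫⁻ p, ‖g p - φ n p‖ₑ ^ α ∂m) atTop (𝓝 0)) :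
    Tendsto (fun n => ∫⁻ p, ‖φ n p‖ₑ ^ α ∂m) atTop (𝓝 (∫⁻ p, ‖g p‖ₑ ^ α ∂m)) := by
  have hk := min_one_inv_pos hα
  have h0 : Tendsto (fun n => lpGauge α m (fun p => g p - φ n p)) atTop (𝓝 0) :=
    (tendsto_lpGauge_zero_iff hα).2 hlim
  have hupper : ∀ n, lpGauge α m (φ n) ≤ lpGauge α m g + lpGauge α m (fun p => g p - φ n p) := by
    intro n
    have h := lpGauge_add_le (m := m) hα hg ((φ n).measurable.sub hg)
    simp only [Pi.sub_apply, add_sub_cancel] at h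
    rwa [lpGauge_sub_comm]
  have hlower : ∀ n, lpGauge α m g - lpGauge α m (fun p => g p - φ n p) ≤ lpGauge α m (φ n) := by
    intro n
    have h := lpGauge_add_le (m := m) hα (φ n).measurable (hg.sub (φ n).measurable)
    simp only [Pi.sub_apply, add_sub_cancel] at h
    exact tsub_le_iff_right.2 h
  have hT : Tendsto (fun n => lpGauge α m (φ n)) atTop (𝓝 (lpGauge α m g)) := by
    refine tendsto_of_tendsto_of_tendsto_of_le_of_le ?_ ?_ hlower hupper
    · simpa using ENNReal.Tendsto.sub (tendsto_const_nhds (x := lpGauge α m g)) h0 (by simp)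
    · simpa using (tendsto_const_nhds (x := lpGauge α m g)).add h0
  have := (ENNReal.continuous_rpow_const (y := (min 1 α⁻¹)⁻¹)).tendsto _ |>.comp hT
  simpa [Function.comp_def, lpGauge, ENNReal.rpow_rpow_inv hk.ne'] using this

end LpFunctional

/-! ### Convergence in measure and linear operations -/

section InMeasure

variable {Ω ι : Type*} [MeasurableSpace Ω] {P : Measure Ω} {l : Filter ι}

lemma tendstoInMeasure_add {X X' : ι → Ω → ℝ} {Y Y' : Ω → ℝ} (h : TendstoInMeasure P X l Y)
    (h' : TendstoInMeasure P X' l Y') :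
    TendstoInMeasure P (fun i ω => X i ω + X' i ω) l (fun ω => Y ω + Y' ω) := by
  rw [tendstoInMeasure_iff_norm] at *
  intro ε hε
  have hsum := (h (ε / 2) (half_pos hε)).add (h' (ε / 2) (half_pos hε))
  rw [add_zero] at hsum
  refine tendsto_of_tendsto_of_tendsto_of_le_of_le tendsto_const_nhds hsum (fun _ => zero_le) ?_
  intro i
  refine (measure_mono fun ω hω => ?_).trans (measure_union_le _ _)
  simp only [Set.mem_ofPred_eq, Set.mem_union] at hω ⊢
  by_contra! hlt
  have := norm_add_le (X i ω - Y ω) (X' i ω - Y' ω)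
  rw [sub_add_sub_comm] at this
  linarith [hlt.1, hlt.2]

lemma tendstoInMeasure_const_mul {X : ι → Ω → ℝ} {Y : Ω → ℝ} (h : TendstoInMeasure P X l Y)
    (c : ℝ) : TendstoInMeasure P (fun i ω => c * X i ω) l (fun ω => c * Y ω) := by
  rw [tendstoInMeasure_iff_norm] at *
  intro ε hε
  have hc : 0 < |c| + 1 := by positivity
  refine tendsto_of_tendsto_of_tendsto_of_le_of_le tendsto_const_nhds
    (h (ε / (|c| + 1)) (by positivity)) (fun _ => zero_le) ?_
  intro i
  refine measure_mono fun ω hω => ?_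
  simp only [Set.mem_ofPred_eq, ← mul_sub, norm_mul, Real.norm_eq_abs] at hω ⊢
  rw [div_le_iff₀ hc]
  nlinarith [abs_nonneg (X i ω - Y ω)]

end InMeasure

/-! ### Integrals of simple functions -/

namespace IsStableRandomMeasure

variable {S Ω : Type*} [MeasurableSpace S] [MeasurableSpace Ω] {P : Measure Ω} {α : ℝ}
  {m : Measure S} {M : Set S → Ω → ℝ}

lemma empty_ae_eq_zero (hM : IsStableRandomMeasure P α m M) : M ∅ =ᵐ[P] 0 := by
  have h := hM.sigma_additive (fun _ => ∅) (fun _ => .empty) (fun _ _ _ => by simp) (by simp)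
  filter_upwards [h] with ω hω
  -- a convergent series has vanishing terms, and here all of them are `M ∅ ω`
  have h1 := (hω.comp (tendsto_add_atTop_nat 1)).sub hω
  simp only [Function.comp_def, Finset.sum_range_succ, add_sub_cancel_left, sub_self] at h1
  exact tendsto_nhds_unique tendsto_const_nhds h1

lemma union_ae_eq (hM : IsStableRandomMeasure P α m M) {A B : Set S} (hA : MeasurableSet A)
    (hB : MeasurableSet B) (hAB : Disjoint A B) (hmA : m A < ∞) (hmB : m B < ∞) :
    M (A ∪ B) =ᵐ[P] fun ω => M A ω + M B ω := by
  set F : ℕ → Set S := fun n => if n = 0 then A else if n = 1 then B else ∅ with hF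
  have hU : ⋃ n, F n = A ∪ B := by
    ext x
    simp only [Set.mem_iUnion, Set.mem_union]
    constructor
    · rintro ⟨n, hn⟩
      rcases n with _ | _ | n
      · exact .inl (by simpa [hF] using hn)
      · exact .inr (by simpa [hF] using hn)
      · simp [hF] at hn
    · rintro (h | h)
      · exact ⟨0, by simpa [hF] using h⟩
      · exact ⟨1, by simpa [hF] using h⟩
  have hFm : ∀ n, MeasurableSet (F n) := by
    intro n
    simp only [hF]
    split_ifs
    exacts [hA, hB, .empty]
  have hFd : Pairwise (Function.onFun Disjoint F) := by
    intro i j hij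
    rcases i with _ | _ | i <;> rcases j with _ | _ | j <;>
      simp_all [Function.onFun, hAB.symm]
  have h := hM.sigma_additive F hFm hFd
    (by rw [hU]; exact (measure_union_le _ _).trans_lt (ENNReal.add_lt_top.2 ⟨hmA, hmB⟩))
  rw [hU] at h
  filter_upwards [h, hM.empty_ae_eq_zero] with ω hω h0
  have hsum : ∀ n, ∑ i ∈ Finset.range (n + 2), M (F i) ω = M A ω + M B ω := by
    intro n
    rw [Finset.sum_range_succ', Finset.sum_range_succ']
    have : ∑ k ∈ Finset.range n, M (F (k + 1 + 1)) ω = 0 :=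
      Finset.sum_eq_zero fun k _ => by simpa [hF] using h0
    rw [this]
    simp [hF, add_comm]
  have h2 := hω.comp (tendsto_add_atTop_nat 2)
  simp only [Function.comp_def, hsum] at h2
  exact tendsto_nhds_unique h2 tendsto_const_nhds

lemma biUnion_ae_eq (hM : IsStableRandomMeasure P α m M) {ι : Type*} (s : Finset ι)
    (A : ι → Set S) (hA : ∀ i ∈ s, MeasurableSet (A i)) (hmA : ∀ i ∈ s, m (A i) < ∞)
    (hd : Pairwise (Function.onFun Disjoint A)) :
    M (⋃ i ∈ s, A i) =ᵐ[P] fun ω => ∑ i ∈ s, M (A i) ω := by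
  classical
  induction s using Finset.induction with
  | empty => simpa [EventuallyEq] using hM.empty_ae_eq_zero
  | insert a s ha ih =>
    have ih := ih (fun i hi => hA i (Finset.mem_insert_of_mem hi))
      (fun i hi => hmA i (Finset.mem_insert_of_mem hi))
    have h := hM.union_ae_eq (A := A a) (B := ⋃ i ∈ s, A i) (hA a (Finset.mem_insert_self _ _))
      (s.measurableSet_biUnion fun i hi => hA i (Finset.mem_insert_of_mem hi))
      (by
        simp only [Set.disjoint_iUnion_right]
        exact fun i hi => hd (by rintro rfl; exact ha hi))
      (hmA a (Finset.mem_insert_self _ _))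
      (measure_biUnion_lt_top s.finite_toSet fun i hi => hmA i (Finset.mem_insert_of_mem hi))
    rw [Finset.set_biUnion_insert]
    filter_upwards [h, ih] with ω h1 h2
    rw [h1, h2, Finset.sum_insert ha]

/-- The integral of `h ∘ ψ` may be computed on the level sets of `ψ`, which are finer than those of
`h ∘ ψ`. Applied to a pair `ψ = (φ₁, φ₂)` this gives additivity of the integral. -/
lemma simpleStableIntegral_map (hM : IsStableRandomMeasure P α m M) {β : Type*} [Zero β]
    (ψ : SimpleFunc S β) (hψ : ψ.FinMeasSupp m) {h : β → ℝ} (h0 : h 0 = 0) :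
    simpleStableIntegral M (ψ.map h) =ᵐ[P] fun ω => ∑ b ∈ ψ.range, h b * M (ψ ⁻¹' {b}) ω := by
  classical
  have hlevel : ∀ y ∈ (ψ.map h).range, ∀ᵐ ω ∂P, y * M (ψ.map h ⁻¹' {y}) ω =
      ∑ b ∈ ψ.range with h b = y, h b * M (ψ ⁻¹' {b}) ω := by
    intro y _
    by_cases hy : y = 0
    · refine ae_of_all _ fun ω => ?_
      rw [hy, zero_mul]
      refine (Finset.sum_eq_zero fun b hb => ?_).symm
      rw [(Finset.mem_filter.1 hb).2, zero_mul]
    · have hset : ψ.map h ⁻¹' {y} = ⋃ b ∈ ψ.range.filter (fun b => h b = y), ψ ⁻¹' {b} := by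
        rw [SimpleFunc.map_preimage_singleton]
        ext x
        simp
      have hb0 : ∀ b ∈ ψ.range.filter (fun b => h b = y), b ≠ 0 := by
        rintro b hb rfl
        exact hy ((Finset.mem_filter.1 hb).2.symm.trans h0)
      have hU := hM.biUnion_ae_eq (ψ.range.filter fun b => h b = y) (fun b => ψ ⁻¹' {b})
        (fun b _ => ψ.measurableSet_fiber b)
        (fun b hb => hψ.meas_preimage_singleton_ne_zero (hb0 b hb))
        (fun i j hij => Disjoint.preimage _ (by simpa using hij))
      rw [hset]
      filter_upwards [hU] with ω hω
      rw [hω, Finset.mul_sum]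
      exact Finset.sum_congr rfl fun b hb => by rw [(Finset.mem_filter.1 hb).2]
  filter_upwards [(Finset.eventually_all _).2 hlevel] with ω hω
  rw [simpleStableIntegral, Finset.sum_congr rfl hω]
  refine Finset.sum_fiberwise_of_maps_to (fun b hb => ?_) _
  obtain ⟨x, rfl⟩ := SimpleFunc.mem_range.1 hb
  exact SimpleFunc.mem_range.2 ⟨x, rfl⟩

lemma simpleStableIntegral_add (hM : IsStableRandomMeasure P α m M) {φ χ : SimpleFunc S ℝ}
    (hφ : φ.FinMeasSupp m) (hχ : χ.FinMeasSupp m) :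
    simpleStableIntegral M (φ + χ) =ᵐ[P]
      fun ω => simpleStableIntegral M φ ω + simpleStableIntegral M χ ω := by
  have hp := hφ.pair hχ
  have h1 := hM.simpleStableIntegral_map (φ.pair χ) hp (h := Prod.fst) rfl
  have h2 := hM.simpleStableIntegral_map (φ.pair χ) hp (h := Prod.snd) rfl
  have h3 := hM.simpleStableIntegral_map (φ.pair χ) hp (h := fun q => q.1 + q.2) (by simp)
  have e1 : (φ.pair χ).map Prod.fst = φ := rfl
  have e2 : (φ.pair χ).map Prod.snd = χ := rfl
  have e3 : (φ.pair χ).map (fun q => q.1 + q.2) = φ + χ := rfl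
  rw [e1] at h1
  rw [e2] at h2
  rw [e3] at h3
  filter_upwards [h1, h2, h3] with ω h1 h2 h3
  rw [h1, h2, h3, ← Finset.sum_add_distrib]
  exact Finset.sum_congr rfl fun b _ => add_mul _ _ _

lemma simpleStableIntegral_const_mul (hM : IsStableRandomMeasure P α m M) {φ : SimpleFunc S ℝ}
    (hφ : φ.FinMeasSupp m) (c : ℝ) :
    simpleStableIntegral M (φ.map (c * ·)) =ᵐ[P] fun ω => c * simpleStableIntegral M φ ω := by
  filter_upwards [hM.simpleStableIntegral_map φ hφ (h := (c * ·)) (by simp)] with ω h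
  rw [h, simpleStableIntegral, Finset.mul_sum]
  exact Finset.sum_congr rfl fun b _ => mul_assoc _ _ _

lemma measurable_mul_fiber (hM : IsStableRandomMeasure P α m M) {φ : SimpleFunc S ℝ}
    (hφ : φ.FinMeasSupp m) (y : ℝ) : Measurable fun ω => y * M (φ ⁻¹' {y}) ω := by
  by_cases hy : y = 0
  · simp [hy]
  · exact (hM.measurable _ (φ.measurableSet_fiber y)
      (hφ.meas_preimage_singleton_ne_zero hy)).const_mul y

lemma measurable_simpleStableIntegral (hM : IsStableRandomMeasure P α m M) {φ : SimpleFunc S ℝ}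
    (hφ : φ.FinMeasSupp m) : Measurable (simpleStableIntegral M φ) :=
  Finset.measurable_fun_sum _ fun y _ => hM.measurable_mul_fiber hφ y

/-- The axiom asks for independence along sequences of sets; a countable family becomes a sequence
by filling up with empty sets. -/
lemma iIndepFun_of_countable (hM : IsStableRandomMeasure P α m M) {ι : Type*} [Countable ι]
    (A : ι → Set S) (hA : ∀ i, MeasurableSet (A i)) (hmA : ∀ i, m (A i) < ∞)
    (hd : Pairwise (Function.onFun Disjoint A)) : iIndepFun (fun i => M (A i)) P := by
  obtain ⟨e, he⟩ := Countable.exists_injective_nat ι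
  set F : ℕ → Set S := Function.extend e A fun _ => ∅ with hF
  have hFe : ∀ i, F (e i) = A i := fun i => he.extend_apply _ _ _
  have hF0 : ∀ n, (¬ ∃ i, e i = n) → F n = ∅ := fun n hn => Function.extend_apply' _ _ _ hn
  have h := hM.indep F ?_ ?_ ?_
  · simpa only [hFe] using h.precomp he
  · intro n
    by_cases hn : ∃ i, e i = n
    · obtain ⟨i, rfl⟩ := hn
      rw [hFe]
      exact hA i
    · simp [hF0 n hn]
  · intro n
    by_cases hn : ∃ i, e i = n
    · obtain ⟨i, rfl⟩ := hn
      rw [hFe]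
      exact hmA i
    · simp [hF0 n hn]
  · intro a b hab
    by_cases ha : ∃ i, e i = a
    · by_cases hb : ∃ j, e j = b
      · obtain ⟨i, rfl⟩ := ha
        obtain ⟨j, rfl⟩ := hb
        simp only [Function.onFun, hFe]
        exact hd fun hij => hab (by rw [hij])
      · simp [Function.onFun, hF0 b hb]
    · simp [Function.onFun, hF0 a ha]

lemma charFun_simpleStableIntegral (hα : 0 < α) (hM : IsStableRandomMeasure P α m M)
    {φ : SimpleFunc S ℝ} (hφ : φ.FinMeasSupp m) (t : ℝ) :
    charFun (P.map (simpleStableIntegral M φ)) t =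
      ((Real.exp (-(|t| ^ α * (∫⁻ p, ‖φ p‖ₑ ^ α ∂m).toReal)) : ℝ) : ℂ) := by
  classical
  -- the level set of the value `0` may have infinite measure and is left out
  set s : Finset ℝ := φ.range.erase 0 with hs
  have hs0 : ∀ y ∈ s, y ≠ 0 := fun y hy => Finset.ne_of_mem_erase hy
  have hfin : ∀ y ∈ s, m (φ ⁻¹' {y}) < ∞ :=
    fun y hy => hφ.meas_preimage_singleton_ne_zero (hs0 y hy)
  have hI : simpleStableIntegral M φ = fun ω => ∑ y ∈ s, y * M (φ ⁻¹' {y}) ω := by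
    funext ω
    rw [simpleStableIntegral, hs, Finset.sum_erase _ (by simp)]
  have hind : iIndepFun (s.restrict fun y ω => y * M (φ ⁻¹' {y}) ω) P :=
    (hM.iIndepFun_of_countable (fun y : s => φ ⁻¹' {y.1}) (fun y => φ.measurableSet_fiber _)
      (fun y => hfin y y.2) (fun i j hij => Disjoint.preimage _
        (by simpa using fun h => hij (Subtype.ext h)))).comp
      (fun y x => y.1 * x) fun y => measurable_const_mul y.1
  have hlint : ∫⁻ p, ‖φ p‖ₑ ^ α ∂m = ∑ y ∈ s, ‖y‖ₑ ^ α * m (φ ⁻¹' {y}) := by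
    have h := SimpleFunc.map_lintegral (μ := m) (fun y : ℝ => ‖y‖ₑ ^ α) φ
    rw [← SimpleFunc.lintegral_eq_lintegral] at h
    rw [hs, Finset.sum_erase _ (by simp [hα]), ← h]
    rfl
  rw [hI, iIndepFun.charFun_map_fun_finsetSum_eq_prod
    (fun y _ => (hM.measurable_mul_fiber hφ y).aemeasurable) hind, Finset.prod_apply, hlint,
    ENNReal.toReal_sum fun y hy => ENNReal.mul_ne_top (by simp [hα.le]) (hfin y hy).ne,
    Finset.mul_sum, ← Finset.sum_neg_distrib, Real.exp_sum, Complex.ofReal_prod]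
  refine Finset.prod_congr rfl fun y hy => ?_
  have hmap : P.map (fun ω => y * M (φ ⁻¹' {y}) ω) = (P.map (M (φ ⁻¹' {y}))).map (y * ·) := by
    rw [Measure.map_map (measurable_const_mul y)
      (hM.measurable _ (φ.measurableSet_fiber y) (hfin y hy))]
    rfl
  rw [hmap, charFun_map_mul, hM.charFun_eq _ (φ.measurableSet_fiber y) (hfin y hy), abs_mul,
    Real.mul_rpow (abs_nonneg _) (abs_nonneg _), ENNReal.toReal_mul, ← ENNReal.toReal_rpow,
    toReal_enorm, Real.norm_eq_abs]
  congr 3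
  ring

end IsStableRandomMeasure

/-! ### Stable integrals -/

namespace IsStableIntegral

variable {S Ω : Type*} [MeasurableSpace S] [MeasurableSpace Ω] {P : Measure Ω} {α : ℝ}
  {m : Measure S} {M : Set S → Ω → ℝ} {g h : S → ℝ} {X Y : Ω → ℝ}

lemma aemeasurable (hM : IsStableRandomMeasure P α m M) (hX : IsStableIntegral P α m M g X) :
    AEMeasurable X P := by
  obtain ⟨φ, hφ, -, hlim⟩ := hX
  exact hlim.aemeasurable fun n => (hM.measurable_simpleStableIntegral (hφ n)).aemeasurable

lemma zero (hα : 0 < α) :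
    IsStableIntegral P α m M (fun _ => 0) fun _ => 0 := by
  have hI : simpleStableIntegral M (0 : SimpleFunc S ℝ) = fun _ => 0 := by
    funext ω
    refine Finset.sum_eq_zero fun y hy => ?_
    obtain ⟨x, rfl⟩ := SimpleFunc.mem_range.1 hy
    simp
  refine ⟨fun _ => (0 : SimpleFunc S ℝ), fun _ => ?_, by simp [hα], ?_⟩
  · rw [SimpleFunc.finMeasSupp_iff]
    intro y hy
    have hpre : (0 : SimpleFunc S ℝ) ⁻¹' {y} = ∅ := by
      ext x
      simpa using hy.symm
    rw [hpre, measure_empty]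
    exact ENNReal.zero_lt_top
  · simp only [hI]
    rw [tendstoInMeasure_iff_norm]
    intro ε hε
    simp [hε.not_ge]

lemma add (hα : 0 < α) (hM : IsStableRandomMeasure P α m M) (hg : Measurable g)
    (hh : Measurable h) (hX : IsStableIntegral P α m M g X) (hY : IsStableIntegral P α m M h Y) :
    IsStableIntegral P α m M (fun p => g p + h p) fun ω => X ω + Y ω := by
  obtain ⟨φ, hφ, hφg, hφX⟩ := hX
  obtain ⟨χ, hχ, hχh, hχY⟩ := hY
  refine ⟨fun n => φ n + χ n, fun n => (hφ n).add (hχ n), ?_, ?_⟩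
  · rw [← tendsto_lpGauge_zero_iff hα] at *
    have hsum := hφg.add hχh
    rw [add_zero] at hsum
    refine tendsto_of_tendsto_of_tendsto_of_le_of_le tendsto_const_nhds hsum (fun _ => zero_le) ?_
    intro n
    have h1 := lpGauge_add_le (m := m) hα (hg.sub (φ n).measurable) (hh.sub (χ n).measurable)
    simp only [Pi.sub_apply, sub_add_sub_comm] at h1
    exact h1
  · exact (tendstoInMeasure_add hφX hχY).congr_left
      fun n => (hM.simpleStableIntegral_add (hφ n) (hχ n)).symm

lemma const_mul (hα : 0 < α) (hM : IsStableRandomMeasure P α m M)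
    (hX : IsStableIntegral P α m M g X) (c : ℝ) :
    IsStableIntegral P α m M (fun p => c * g p) fun ω => c * X ω := by
  obtain ⟨φ, hφ, hφg, hφX⟩ := hX
  refine ⟨fun n => (φ n).map (c * ·), fun n => (hφ n).map (by simp), ?_, ?_⟩
  · have h1 : ∀ n, ∫⁻ p, ‖c * g p - (φ n).map (c * ·) p‖ₑ ^ α ∂m =
        ‖c‖ₑ ^ α * ∫⁻ p, ‖g p - φ n p‖ₑ ^ α ∂m := by
      intro n
      rw [← lintegral_const_mul' _ _ (by simp [hα.le])]
      refine lintegral_congr fun p => ?_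
      rw [SimpleFunc.map_apply, ← mul_sub, enorm_mul, ENNReal.mul_rpow_of_nonneg _ _ hα.le]
    simp only [h1]
    simpa using ENNReal.Tendsto.const_mul (a := ‖c‖ₑ ^ α) hφg (.inr (by simp [hα.le]))
  · exact (tendstoInMeasure_const_mul hφX c).congr_left
      fun n => (hM.simpleStableIntegral_const_mul (hφ n) c).symm

lemma sum_mul (hα : 0 < α) (hM : IsStableRandomMeasure P α m M) {ι : Type*} (s : Finset ι)
    {g : ι → S → ℝ} {X : ι → Ω → ℝ} (hg : ∀ i, Measurable (g i))
    (hX : ∀ i, IsStableIntegral P α m M (g i) (X i)) (a : ι → ℝ) :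
    IsStableIntegral P α m M (fun p => ∑ i ∈ s, a i * g i p) fun ω => ∑ i ∈ s, a i * X i ω := by
  classical
  induction s using Finset.induction with
  | empty => simpa using zero hα
  | insert i s hi ih =>
    simp only [Finset.sum_insert hi]
    exact add hα hM ((hg i).const_mul _)
      (Finset.measurable_fun_sum _ fun j _ => (hg j).const_mul _)
      ((hX i).const_mul hα hM _) ih

lemma lintegral_lt_top (hα : 0 < α) (hg : Measurable g)
    (hX : IsStableIntegral P α m M g X) : ∫⁻ p, ‖g p‖ₑ ^ α ∂m < ∞ := by
  obtain ⟨φ, hφ, hφg, -⟩ := hX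
  exact lintegral_rpow_lt_top_of_tendsto hα hg hφ hφg

/-- A stable integral is symmetric `α`-stable, with scale given by the `L^α` size of the
integrand. -/
lemma charFun_eq [IsProbabilityMeasure P] (hα : 0 < α) (hM : IsStableRandomMeasure P α m M)
    (hg : Measurable g) (hX : IsStableIntegral P α m M g X) (t : ℝ) :
    charFun (P.map X) t =
      ((Real.exp (-(|t| ^ α * (∫⁻ p, ‖g p‖ₑ ^ α ∂m).toReal)) : ℝ) : ℂ) := by
  have hfin := hX.lintegral_lt_top hα hg
  obtain ⟨φ, hφ, hφg, hφX⟩ := hX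
  have hdist := hφX.tendstoInDistribution
    fun n => (hM.measurable_simpleStableIntegral (hφ n)).aemeasurable
  have h1 := ProbabilityMeasure.tendsto_iff_tendsto_charFun.1 hdist.tendsto t
  have h2 := (ENNReal.tendsto_toReal hfin.ne).comp (tendsto_lintegral_rpow hα hg hφg)
  have h3 := (Complex.continuous_ofReal.tendsto _).comp
    ((Real.continuous_exp.tendsto _).comp (h2.const_mul (|t| ^ α)).neg)
  refine tendsto_nhds_unique h1 (h3.congr fun n => ?_)
  exact (hM.charFun_simpleStableIntegral hα (hφ n) t).symm

lemma ae_eq_zero [IsProbabilityMeasure P] (hα : 0 < α) (hM : IsStableRandomMeasure P α m M)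
    (hg : Measurable g) (hX : IsStableIntegral P α m M g X)
    (h0 : ∫⁻ p, ‖g p‖ₑ ^ α ∂m = 0) : X =ᵐ[P] 0 := by
  have hXm := hX.aemeasurable hM
  have := Measure.isProbabilityMeasure_map hXm
  have hdirac : P.map X = Measure.dirac 0 := by
    refine Measure.ext_of_charFun (funext fun t => ?_)
    rw [hX.charFun_eq hα hM hg, h0]
    simp [charFun_dirac]
  have h1 : ∀ᵐ x ∂P.map X, x = 0 := by
    rw [hdirac, ae_dirac_eq]
    exact eventually_pure.2 rfl
  exact ae_of_ae_map hXm h1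

/-- The law of a finite family of stable integrals is determined by the `L^α` sizes of the linear
combinations of the integrands: by linearity of the integral, these give the characteristic
functional of the family. -/
lemma identDistrib [IsProbabilityMeasure P] (hα : 0 < α) (hM : IsStableRandomMeasure P α m M)
    {ι : Type*} [Fintype ι] {g h : ι → S → ℝ} {X Y : ι → Ω → ℝ} (hg : ∀ i, Measurable (g i))
    (hh : ∀ i, Measurable (h i)) (hX : ∀ i, IsStableIntegral P α m M (g i) (X i))
    (hY : ∀ i, IsStableIntegral P α m M (h i) (Y i))
    (heq : ∀ a : ι → ℝ, ∫⁻ p, ‖∑ i, a i * g i p‖ₑ ^ α ∂m = ∫⁻ p, ‖∑ i, a i * h i p‖ₑ ^ α ∂m) :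
    IdentDistrib (fun ω i => X i ω) (fun ω i => Y i ω) P P := by
  classical
  have hXm : AEMeasurable (fun ω i => X i ω) P :=
    aemeasurable_pi_lambda _ fun i => (hX i).aemeasurable hM
  have hYm : AEMeasurable (fun ω i => Y i ω) P :=
    aemeasurable_pi_lambda _ fun i => (hY i).aemeasurable hM
  refine ⟨hXm, hYm, ?_⟩
  have := Measure.isProbabilityMeasure_map hXm
  have := Measure.isProbabilityMeasure_map hYm
  refine Measure.ext_of_charFunDual (funext fun L => ?_)
  have key : ∀ {k : ι → S → ℝ} {Z : ι → Ω → ℝ}, (∀ i, Measurable (k i)) →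
      (∀ i, IsStableIntegral P α m M (k i) (Z i)) → AEMeasurable (fun ω i => Z i ω) P →
      charFunDual (P.map fun ω i => Z i ω) L = ((Real.exp (-(|1| ^ α *
        (∫⁻ p, ‖∑ i, L (Pi.single i 1) * k i p‖ₑ ^ α ∂m).toReal)) : ℝ) : ℂ) := by
    intro k Z hk hZ hZm
    have hL : (fun ω => ∑ i, L (Pi.single i 1) * Z i ω) = L ∘ fun ω i => Z i ω := by
      funext ω
      have := (L : (ι → ℝ) →ₗ[ℝ] ℝ).pi_apply_eq_sum_univ fun i => Z i ω
      simp only [ContinuousLinearMap.coe_coe] at this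
      rw [Function.comp_apply, this]
      refine Finset.sum_congr rfl fun i _ => ?_
      rw [smul_eq_mul, mul_comm]
      congr 2
      ext j
      simp [Pi.single_apply, eq_comm]
    have h1 := (sum_mul hα hM Finset.univ hk hZ fun i => L (Pi.single i 1)).charFun_eq hα hM
      (Finset.measurable_fun_sum _ fun i _ => (hk i).const_mul _) 1
    rw [charFunDual_eq_charFun_map_one,
      AEMeasurable.map_map_of_aemeasurable L.continuous.measurable.aemeasurable hZm, ← hL]
    exact h1
  rw [key hg hX hXm, key hh hY hYm, heq]

end IsStableIntegral

/-! ### Scaling of the kernels -/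

section Scaling

variable {W : Type*} [MeasurableSpace W] {Q : Measure W} {α : ℝ} {f : W × ℝ → ℝ}

lemma measurable_movingAverageKernel (hf : Measurable f) (t : ℝ) :
    Measurable (movingAverageKernel f t) := by
  unfold movingAverageKernel
  fun_prop

lemma measurable_incr (hf : Measurable f) (t : ℝ) : Measurable (incr f t) := by
  unfold incr
  fun_prop

/-- The reflection `s ↦ -s` turns the kernels of the process into the increments of `f`. -/
lemma lintegral_movingAverageKernel [SFinite Q] (hf : Measurable f) {ι : Type*} (s : Finset ι)
    (a τ : ι → ℝ) :
    ∫⁻ p, ‖∑ i ∈ s, a i * movingAverageKernel f (τ i) p‖ₑ ^ α ∂(Q.prod (volume : Measure ℝ)) =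
      ∫⁻ p, ‖∑ i ∈ s, a i * incr f (τ i) p‖ₑ ^ α ∂(Q.prod (volume : Measure ℝ)) := by
  have hmp : MeasurePreserving (Prod.map id Neg.neg) (Q.prod (volume : Measure ℝ))
      (Q.prod (volume : Measure ℝ)) :=
    (MeasurePreserving.id Q).prod (Measure.measurePreserving_neg volume)
  have hF : Measurable fun p : W × ℝ => ‖∑ i ∈ s, a i * incr f (τ i) p‖ₑ ^ α :=
    (Finset.measurable_fun_sum _ fun i _ =>
      (measurable_incr hf (τ i)).const_mul (a i)).enorm.pow_const α
  rw [← hmp.lintegral_comp hF]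
  rfl

/-- A measurable bijection `ρ` with `Q ∘ ρ = b Q`, combined with the dilation by `c`, multiplies
`Q ⊗ Leb` by `b c`. -/
lemma lintegral_prod_scaling [SigmaFinite Q] {c : ℝ} (hc : 0 < c)
    {b : ℝ≥0∞} {ρ : W → W} (hρ : Function.Bijective ρ) (hρm : Measurable ρ)
    (hQ : ∀ A : Set W, MeasurableSet A → Q (ρ '' A) = b * Q A) {F : W × ℝ → ℝ≥0∞}
    (hF : Measurable F) :
    ∫⁻ p, F p ∂(Q.prod (volume : Measure ℝ)) =
      b * ENNReal.ofReal c * ∫⁻ p, F (ρ p.1, c * p.2) ∂(Q.prod (volume : Measure ℝ)) := by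
  have hQmap : b • Q.map ρ = Q := by
    ext B hB
    rw [Measure.smul_apply, smul_eq_mul, Measure.map_apply hρm hB, ← hQ _ (hρm hB),
      Set.image_preimage_eq _ hρ.surjective]
  have hvol : ENNReal.ofReal c • (volume : Measure ℝ).map (c * ·) = volume := by
    have := Real.smul_map_volume_mul_left hc.ne'
    rwa [abs_of_pos hc] at this
  have hprod : Q.prod (volume : Measure ℝ) = (b * ENNReal.ofReal c) •
      (Q.prod (volume : Measure ℝ)).map (Prod.map ρ (c * ·)) := by
    conv_lhs => rw [← hQmap, ← hvol]
    rw [Measure.prod_smul_left, Measure.prod_smul_right, smul_smul,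
      Measure.map_prod_map _ _ hρm (measurable_const_mul c)]
  conv_lhs => rw [hprod]
  rw [lintegral_smul_measure, smul_eq_mul,
    lintegral_map hF (hρm.prodMap (measurable_const_mul c))]
  rfl

lemma lintegral_movingAverageKernel_scaling [SigmaFinite Q] (hα : 0 < α)
    (hf : Measurable f) {β₁ β₂ c : ℝ} (hc : 0 < c) {ρ : W → W} (hρ : Function.Bijective ρ)
    (hρm : Measurable ρ)
    (hincr : ∀ t : ℝ, ∀ᵐ p ∂(Q.prod (volume : Measure ℝ)),
      incr f (c * t) (ρ p.1, c * p.2) = c ^ β₁ * incr f t p)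
    (hQ : ∀ A : Set W, MeasurableSet A → Q (ρ '' A) = ENNReal.ofReal (c ^ β₂) * Q A)
    {ι : Type*} (s : Finset ι) (a τ : ι → ℝ) :
    ∫⁻ p, ‖∑ i ∈ s, a i * movingAverageKernel f (c * τ i) p‖ₑ ^ α
        ∂(Q.prod (volume : Measure ℝ)) =
      ENNReal.ofReal (c ^ (α * β₁ + β₂ + 1)) *
        ∫⁻ p, ‖∑ i ∈ s, a i * movingAverageKernel f (τ i) p‖ₑ ^ α
          ∂(Q.prod (volume : Measure ℝ)) := by
  have hF : Measurable fun p : W × ℝ => ‖∑ i ∈ s, a i * incr f (c * τ i) p‖ₑ ^ α :=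
    (Finset.measurable_fun_sum _ fun i _ =>
      (measurable_incr hf (c * τ i)).const_mul (a i)).enorm.pow_const α
  have hcβ : 0 < c ^ β₁ := Real.rpow_pos_of_pos hc _
  have hpt : ∀ᵐ p ∂(Q.prod (volume : Measure ℝ)),
      ‖∑ i ∈ s, a i * incr f (c * τ i) (ρ p.1, c * p.2)‖ₑ ^ α =
        ENNReal.ofReal (c ^ (α * β₁)) * ‖∑ i ∈ s, a i * incr f (τ i) p‖ₑ ^ α := by
    filter_upwards [(Finset.eventually_all s).2 fun i _ => hincr (τ i)] with p hp
    have hsum : ∑ i ∈ s, a i * incr f (c * τ i) (ρ p.1, c * p.2) =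
        c ^ β₁ * ∑ i ∈ s, a i * incr f (τ i) p := by
      rw [Finset.mul_sum]
      exact Finset.sum_congr rfl fun i hi => by rw [hp i hi, mul_left_comm]
    rw [hsum, enorm_mul, ENNReal.mul_rpow_of_nonneg _ _ hα.le, Real.enorm_of_nonneg hcβ.le,
      ENNReal.ofReal_rpow_of_pos hcβ, ← Real.rpow_mul hc.le, mul_comm α β₁]
  rw [lintegral_movingAverageKernel hf, lintegral_movingAverageKernel hf,
    lintegral_prod_scaling hc hρ hρm hQ hF, lintegral_congr_ae hpt,
    lintegral_const_mul' _ _ ENNReal.ofReal_ne_top, ← mul_assoc,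
    ← ENNReal.ofReal_mul (Real.rpow_nonneg hc.le _),
    ← ENNReal.ofReal_mul (mul_nonneg (Real.rpow_nonneg hc.le _) hc.le)]
  congr 2
  rw [Real.rpow_add hc, Real.rpow_add hc, Real.rpow_one]
  ring

end Scaling

/-- The scaling relation holds in every case; the positivity of the exponent, which is part of the
definition of self-similarity, can only fail for the process that vanishes almost surely. -/
theorem corollary3p13 {W Ω : Type*} [MeasurableSpace W] [StandardBorelSpace W]
    [MeasurableSpace Ω] (P : Measure Ω) [IsProbabilityMeasure P]
    (Q : Measure W) [SigmaFinite Q]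
    (α : ℝ) (hα0 : 0 < α) (hα2 : α ≤ 2)
    (f : W × ℝ → ℝ) (hf : IsAdmissible α Q f)
    (N : Set (W × ℝ) → Ω → ℝ)
    (hN : IsStableRandomMeasure P α (Q.prod (volume : Measure ℝ)) N)
    (X : ℝ → Ω → ℝ)
    (hX : ∀ t : ℝ, IsStableIntegral P α (Q.prod (volume : Measure ℝ)) N
      (movingAverageKernel f t) (X t))
    (β₁ β₂ : ℝ)
    (hρ : ∀ c : ℝ, 0 < c → ∃ ρ : W → W, Function.Bijective ρ ∧ Measurable ρ ∧
      (∀ t : ℝ, ∀ᵐ p ∂(Q.prod (volume : Measure ℝ)),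
        incr f (c * t) (ρ p.1, c * p.2) = c ^ β₁ * incr f t p) ∧
      (∀ A : Set W, MeasurableSet A → Q (ρ '' A) = ENNReal.ofReal (c ^ β₂) * Q A)) :
    SelfSimilarScaling P X ((α * β₁ + β₂ + 1) / α) ∧
      ((∃ t : ℝ, ¬ X t =ᵐ[P] 0) → IsSelfSimilar P X ((α * β₁ + β₂ + 1) / α)) := by
  have hmeas := measurable_movingAverageKernel hf.measurable
  set H : ℝ := (α * β₁ + β₂ + 1) / α with hH
  have hHα : H * α = α * β₁ + β₂ + 1 := div_mul_cancel₀ _ hα0.ne'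
  have hscal : SelfSimilarScaling P X H := by
    intro c hc I
    obtain ⟨ρ, hρb, hρm, hincr, hQ⟩ := hρ c hc
    have hcH : 0 < c ^ H := Real.rpow_pos_of_pos hc _
    refine IsStableIntegral.identDistrib (ι := I) (g := fun t => movingAverageKernel f (c * t))
      (h := fun t p => c ^ H * movingAverageKernel f t p) (X := fun t => X (c * t))
      (Y := fun t ω => c ^ H * X t ω) hα0 hN (fun t => hmeas _)
      (fun t => (hmeas _).const_mul _) (fun t => hX _)
      (fun t => (hX t).const_mul hα0 hN _) fun a => ?_
    rw [lintegral_movingAverageKernel_scaling hα0 hf.measurable hc hρb hρm hincr hQ Finset.univ a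
      fun t => t, ← lintegral_const_mul' _ _ ENNReal.ofReal_ne_top]
    refine lintegral_congr fun p => ?_
    have hsum : ∑ t : I, a t * (c ^ H * movingAverageKernel f t p) =
        c ^ H * ∑ t : I, a t * movingAverageKernel f t p := by
      rw [Finset.mul_sum]
      exact Finset.sum_congr rfl fun t _ => mul_left_comm _ _ _
    rw [hsum, enorm_mul, ENNReal.mul_rpow_of_nonneg _ _ hα0.le, Real.enorm_of_nonneg hcH.le,
      ENNReal.ofReal_rpow_of_pos hcH, ← Real.rpow_mul hc.le, hHα]
  refine ⟨hscal, fun ⟨t, ht⟩ => ⟨?_, hscal⟩⟩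
  by_contra! hH0
  set v : ℝ → ℝ≥0∞ := fun t =>
    ∫⁻ p, ‖movingAverageKernel f t p‖ₑ ^ α ∂(Q.prod (volume : Measure ℝ)) with hv
  have hvt : v t ≠ 0 := fun h0 => ht ((hX t).ae_eq_zero hα0 hN (hmeas t) h0)
  -- if `H ≤ 0`, then `v (c t) = c ^ (α H) v t ≥ v t` for `c ≤ 1`, against `v (c t) → 0`
  have hle : ∀ c : ℝ, 0 < c → c ≤ 1 → v t ≤ v (c * t) := by
    intro c hc hc1
    obtain ⟨ρ, hρb, hρm, hincr, hQ⟩ := hρ c hc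
    have h := lintegral_movingAverageKernel_scaling hα0 hf.measurable hc hρb hρm hincr hQ
      Finset.univ (fun _ : Unit => 1) fun _ => t
    simp only [Finset.univ_unique, Finset.sum_singleton, one_mul] at h
    simp only [hv]
    rw [h]
    refine le_mul_of_one_le_left zero_le ?_
    rw [ENNReal.one_le_ofReal, ← hHα]
    exact Real.one_le_rpow_of_pos_of_le_one_of_nonpos hc hc1
      (mul_nonpos_of_nonpos_of_nonneg hH0 hα0.le)
  have hlim : Tendsto (fun c : ℝ => v (c * t)) (𝓝[>] 0) (𝓝 0) := by
    refine hf.tendsto_zero.comp (tendsto_nhdsWithin_of_tendsto_nhds ?_)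
    simpa using (continuous_mul_const t).tendsto 0
  have hle0 : v t ≤ 0 := by
    refine ge_of_tendsto hlim ?_
    filter_upwards [Ioc_mem_nhdsGT (zero_lt_one' ℝ)] with c hc
    exact hle c hc.1 hc.2
  exact hvt (le_antisymm hle0 zero_le)
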